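/- Let $W_0,B_0,c,m\ge 1$ be integers. An urn initially contains $W_0$ white and $B_0$ black balls, $T_0=W_0+B_0$. In each step $m$ balls are drawn from the urn one by one with replacement, and if the sample contains $k$ white and $m-k$ black balls ($0\le k\le m$), then $ck$ white and $c(m-k)$ black balls are added to the urn (model R). Let $W_n$ and $B_n$ be the numbers of white and black balls after $n$ draws, let $T_n=W_n+B_n=T_0+nmc$, and let $\mathcal F_n$ be the $\sigma$-field generated by the compositions of the first $n$ samples; thus, for $n\ge 1$ and $0\le k\le m$, $$\mathbb P\{\text{the } n\text{-th sample contains exactly } k \text{ white balls}\mid \mathcal F_{n-1}\}=\binom mk\frac{W_{n-1}^k\,B_{n-1}^{m-k}}{T_{n-1}^m}.$$ Then $\mathcal W_n=W_n/T_n$, $n\ge 0$, is a positive martingale with respect to $(\mathcal F_n)_{n\ge 0}$, and it converges almost surely to a random variable $\mathcal W_\infty$. The law of $\mathcal W_\infty$ is absolutely continuous with respect to Lebesgue measure on $\mathbb R$. -/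

import Mathlib

open MeasureTheory Filter Topology

namespace UrnR

variable {Ω : Type*}

/-- Number of white balls after `n` draws, where `D i` is the number of white balls in the
sample of the `(i+1)`-st draw and `c` balls are added for each ball of the sample. -/
def white (W₀ c : ℕ) (D : ℕ → Ω → ℕ) (n : ℕ) (ω : Ω) : ℕ :=
  W₀ + ∑ i ∈ Finset.range n, c * D i ω

/-- Number of black balls after `n` draws: the sample of the `(i+1)`-st draw has
`m - D i` black balls. -/
def black (B₀ c m : ℕ) (D : ℕ → Ω → ℕ) (n : ℕ) (ω : Ω) : ℕ :=
  B₀ + ∑ i ∈ Finset.range n, c * (m - D i ω)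

/-- Total number of balls after `n` draws. -/
def total (W₀ B₀ c m n : ℕ) : ℕ := W₀ + B₀ + n * m * c

/-- Consistency check: white plus black balls is the total number of balls. -/
theorem white_add_black (W₀ B₀ c m : ℕ) (D : ℕ → Ω → ℕ) (hD : ∀ n ω, D n ω ≤ m)
    (n : ℕ) (ω : Ω) :
    white W₀ c D n ω + black B₀ c m D n ω = total W₀ B₀ c m n := by
  have h : ∀ i ∈ Finset.range n, c * D i ω + c * (m - D i ω) = c * m := by
    intro i _
    rw [← Nat.mul_add, Nat.add_sub_cancel' (hD i ω)]
  have h2 := Finset.sum_congr rfl h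
  rw [Finset.sum_add_distrib, Finset.sum_const, Finset.card_range, smul_eq_mul] at h2
  have h3 : n * m * c = n * (c * m) := by ring
  unfold white black total
  omega

/-- The filtration generated by the draws: the `n`-th σ-algebra is generated by the first `n`
draws `D 0, …, D (n-1)`. -/
def drawFiltration [mΩ : MeasurableSpace Ω] (D : ℕ → Ω → ℕ) (hD : ∀ n, Measurable (D n)) :
    Filtration ℕ mΩ where
  seq n := ⨆ i ∈ Finset.range n, MeasurableSpace.comap (D i) inferInstance
  mono' _ _ hab :=
    biSup_mono fun _ hi => Finset.mem_range.2 (lt_of_lt_of_le (Finset.mem_range.1 hi) hab)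
  le' _ := iSup₂_le fun i _ => (hD i).comap_le

/-- `D` is the sequence of sample compositions of an urn of model R (drawing `m` balls with
replacement and adding `c` balls of the same colour for each ball of the sample), started with
`W₀` white and `B₀` black balls: given the first `n` draws, the number `D n` of white balls in the
next sample is binomial with parameters `m` and the current proportion of white balls. -/
structure IsModelR [MeasurableSpace Ω] (P : Measure Ω) (W₀ B₀ c m : ℕ) (D : ℕ → Ω → ℕ) :
    Prop where
  measurable : ∀ n, Measurable (D n)
  le : ∀ n ω, D n ω ≤ m
  cond_prob : ∀ n k, k ≤ m →
    P[Set.indicator {ω | D n ω = k} (fun _ => (1 : ℝ)) | drawFiltration D measurable n]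
      =ᵐ[P] fun ω =>
        (m.choose k : ℝ) * (white W₀ c D n ω : ℝ) ^ k * (black B₀ c m D n ω : ℝ) ^ (m - k)
          / (total W₀ B₀ c m n : ℝ) ^ m

/-- Proportion of white balls after `n` draws. -/
noncomputable def proportion (W₀ B₀ c m : ℕ) (D : ℕ → Ω → ℕ) (n : ℕ) (ω : Ω) : ℝ :=
  (white W₀ c D n ω : ℝ) / (total W₀ B₀ c m n : ℝ)

end UrnR

/-! The proportion is a martingale with values in `[0,1]`, since a binomial sample has mean `m`
times the current proportion; hence it converges almost surely. For absolute continuity, the point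
probabilities `p_n(v) = P(E ∩ {W_n = v})` are shown to be `O(1/T_n)`, where `E` is an event of the
past on which both colours number at least `c * m`.

If `p_n ≤ a / T` with `T = T_n`, conditioning on the next sample bounds `p_{n+1}(v)` by `a / T ^ (m
+ 1)` times `∑ₖ (m choose k) (v - ck)^k (T - v + ck)^(m - k)`. By Jensen's identity this sum does
not depend on `v`: it equals `T^m - mcT^(m-1) + O(T^(m-2))`. Multiplication by `T_{n+1} = T + mc`
cancels the first-order term, so `sup_v p_n(v) T_n` grows at most by the factor `1 + C / T_n^2`, and
the product of these factors converges.

Counting the integers in `(aT_n, bT_n)` then bounds the law of the limit on `E` by `K (b - a)` on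
each interval `(a, b)`. By the conditional Borel–Cantelli lemma both colours are almost surely added
infinitely often, so countably many such events `E` cover almost everything. -/

/-! ### Finite differences and Jensen's identity -/

/-- The `n`-th finite difference with step `z` of the monomial of degree `n` is `n! z ^ n`. -/
theorem sum_choose_mul_neg_one_pow_mul_add_pow (n : ℕ) (x z : ℝ) :
    ∑ k ∈ Finset.range (n + 1), (n.choose k : ℝ) * (-1) ^ (n - k) * (x + k * z) ^ n
      = n.factorial * z ^ n := by
  rcases eq_or_ne z 0 with rfl | hz
  · have h := add_pow (1 : ℝ) (-1) n
    simp only [one_pow, one_mul] at h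
    simp only [mul_zero, add_zero, ← Finset.sum_mul]
    have h2 : ∑ k ∈ Finset.range (n + 1), (n.choose k : ℝ) * (-1) ^ (n - k) = 0 ^ n := by
      rw [← add_neg_cancel (1 : ℝ), h]
      exact Finset.sum_congr rfl fun k _ => mul_comm _ _
    rw [h2]
    rcases n with _ | n <;> simp
  -- The unit-step difference at `x / z`, rescaled by `z ^ n`; this is why `z = 0` is separate.
  · have h := congrFun (fwdDiff_iter_eq_factorial (R := ℝ) (n := n)) (x / z)
    rw [fwdDiff_iter_eq_sum_shift] at h
    rw [Pi.natCast_apply] at h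
    rw [← h, Finset.sum_mul]
    refine Finset.sum_congr rfl fun k _ => ?_
    have h3 : x + k * z = z * (x / z + k • 1) := by
      rw [nsmul_eq_mul, mul_one]
      field_simp
    rw [h3, mul_pow, zsmul_eq_mul]
    push_cast
    ring

/-- Jensen's identity of Abel type. -/
theorem sum_choose_mul_add_pow_mul_sub_pow (m : ℕ) (x q z : ℝ) :
    ∑ k ∈ Finset.range (m + 1), (m.choose k : ℝ) * (x + k * z) ^ k * (q - (x + k * z)) ^ (m - k)
      = ∑ i ∈ Finset.range (m + 1), (m.choose i : ℝ) * i.factorial * z ^ i * q ^ (m - i) := by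
  -- With `y = x + k z`, expand `(q - y)^(m - k)` in powers of `q` and collect the total power `i`
  -- of `y`. After the sums are swapped, the sum over `k` is the `i`-th finite difference of a
  -- monomial of degree `i`, which no longer involves `x`.
  have h1 : ∀ k ∈ Finset.range (m + 1),
      (m.choose k : ℝ) * (x + k * z) ^ k * (q - (x + k * z)) ^ (m - k)
        = ∑ i ∈ Finset.Ico k (m + 1), (m.choose i : ℝ) * q ^ (m - i) *
            ((i.choose k : ℝ) * (-1) ^ (i - k) * (x + k * z) ^ i) := by
    intro k hk
    have hk' : k ≤ m := Nat.lt_succ_iff.1 (Finset.mem_range.1 hk)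
    rw [Finset.sum_Ico_eq_sum_range, show m + 1 - k = m - k + 1 by omega,
      show q - (x + k * z) = -(x + k * z) + q by ring, add_pow (-(x + k * z)) q,
      Finset.mul_sum]
    refine Finset.sum_congr rfl fun j hj => ?_
    have hj' : j ≤ m - k := Nat.lt_succ_iff.1 (Finset.mem_range.1 hj)
    have h := Nat.choose_mul (n := m) (k := k + j) (s := k) (by omega)
    rw [Nat.add_sub_cancel_left] at h
    have h' : (m.choose (k + j) : ℝ) * (k + j).choose k = m.choose k * (m - k).choose j := by
      exact_mod_cast h
    rw [Nat.add_sub_cancel_left, neg_pow, pow_add, show m - (k + j) = m - k - j by omega]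
    linear_combination (-(x + k * z) ^ k * (-1) ^ j * (x + k * z) ^ j * q ^ (m - k - j)) * h'
  have hmem : ∀ k i, k ∈ Finset.range (m + 1) ∧ i ∈ Finset.Ico k (m + 1) ↔
      k ∈ Finset.range (i + 1) ∧ i ∈ Finset.range (m + 1) := by
    intro k i
    simp only [Finset.mem_range, Finset.mem_Ico]
    omega
  rw [Finset.sum_congr rfl h1, Finset.sum_comm' hmem]
  refine Finset.sum_congr rfl fun i _ => ?_
  rw [← Finset.mul_sum, sum_choose_mul_neg_one_pow_mul_add_pow]
  ring

/-- Second order bound for the sum in Jensen's identity. -/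
theorem exists_jensen_sum_le (c m : ℕ) : ∃ C : ℝ, 0 ≤ C ∧ ∀ T : ℝ, 1 ≤ T →
    (T + m * c) * (∑ i ∈ Finset.range (m + 1),
      (m.choose i : ℝ) * i.factorial * (-c : ℝ) ^ i * T ^ (m - i)) ≤ T ^ m * (T + C / T) := by
  rcases m with _ | m
  · exact ⟨0, le_rfl, fun T _ => by simp⟩
  -- The degree is now `m + 1`. `R` bounds the terms with `i ≥ 2`, signs dropped; the constant
  -- chosen below comes from `T + (m + 1) c ≤ (1 + (m + 1) c) T`, valid for `T ≥ 1`.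
  set R : ℝ := ∑ j ∈ Finset.range m,
    ((m + 1).choose (j + 2) : ℝ) * (j + 2).factorial * (c : ℝ) ^ (j + 2) with hR
  have hR0 : 0 ≤ R := Finset.sum_nonneg fun j _ => by positivity
  refine ⟨(1 + (m + 1) * c) * R, by positivity, fun T hT => ?_⟩
  have hT0 : 0 < T := by linarith
  have h1 : ∑ j ∈ Finset.range m, ((m + 1).choose (j + 2) : ℝ) * (j + 2).factorial *
      (-c : ℝ) ^ (j + 2) * T ^ (m + 1 - (j + 2)) ≤ R * T ^ (m - 1) := by
    rw [hR, Finset.sum_mul]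
    refine Finset.sum_le_sum fun j hj => ?_
    have hj' := Finset.mem_range.1 hj
    have ha : (-c : ℝ) ^ (j + 2) ≤ (c : ℝ) ^ (j + 2) := by
      refine (le_abs_self _).trans ?_
      rw [abs_pow, abs_neg, Nat.abs_cast]
    have hb : T ^ (m + 1 - (j + 2)) ≤ T ^ (m - 1) := pow_le_pow_right₀ hT (by omega)
    gcongr
  -- Split off `i = 0, 1`: `(T + (m+1)c)(T^(m+1) - (m+1)cT^m) = T^(m+2) - (m+1)²c²T^m`. The
  -- first-order terms cancel and the negative square is discarded.
  rw [Finset.sum_range_succ', Finset.sum_range_succ']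
  simp only [add_assoc, Nat.reduceAdd]
  rcases m with _ | m
  · simp only [Finset.range_zero, Finset.sum_empty] at hR ⊢
    simp [hR]
    nlinarith [sq_nonneg (c : ℝ)]
  · simp only [Nat.add_sub_cancel] at h1
    have h2 : T ^ (m + 2) * (T + (1 + ((m + 1 : ℕ) + 1) * c) * R / T)
        = T ^ (m + 3) + (1 + (m + 2) * c) * R * T ^ (m + 1) := by
      push_cast
      field_simp
      ring
    have h3 : (T + (m + 2) * c) * (R * T ^ m) ≤ (1 + (m + 2) * c) * R * T ^ (m + 1) := by
      have : T + (m + 2) * c ≤ (1 + (m + 2) * c) * T := by nlinarith [show 0 ≤ (m + 2 : ℝ) * c by positivity]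
      calc (T + (m + 2) * c) * (R * T ^ m) ≤ ((1 + (m + 2) * c) * T) * (R * T ^ m) := by gcongr
        _ = _ := by ring
    have h4 : (T + (m + 2) * c) * (∑ j ∈ Finset.range (m + 1), ((m + 2).choose (j + 2) : ℝ) *
      (j + 2).factorial * (-c : ℝ) ^ (j + 2) * T ^ (m + 2 - (j + 2))) ≤
        (T + (m + 2) * c) * (R * T ^ m) := by
      gcongr
    have h5 : 0 ≤ (m + 2 : ℝ) ^ 2 * c ^ 2 * T ^ (m + 1) := by positivity
    rw [h2]
    simp only [Nat.choose_one_right, Nat.factorial_one, Nat.choose_zero_right, Nat.factorial_zero,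
      pow_zero, pow_one, tsub_zero, Nat.cast_one, mul_one, one_mul,
      show m + 2 - 1 = m + 1 by omega]
    push_cast at h4 ⊢
    rw [show (m : ℝ) + 1 + 1 = m + 2 by ring] at *
    rw [mul_add]
    refine (add_le_add_left (h4.trans h3) _).trans ?_
    linear_combination h5

/-! ### A criterion for absolute continuity, and counting -/

/-- A measure on the line that is at most proportional to length on bounded open intervals is
absolutely continuous. -/
theorem absolutelyContinuous_of_measure_Ioo_le {μ : Measure ℝ} {K : ℝ} (hK : 0 < K)
    (h : ∀ a b : ℝ, a < b → μ (Set.Ioo a b) ≤ ENNReal.ofReal (K * (b - a))) : μ ≪ volume := by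
  have hIoc : ∀ a b : ℝ, μ (Set.Ioc a b) ≤ ENNReal.ofReal (K * (b - a)) := by
    intro a b
    rcases le_or_gt b a with hab | hab
    · simp [Set.Ioc_eq_empty hab.not_gt]
    have ht : Tendsto (fun ε : ℝ => ENNReal.ofReal (K * (b + ε - a))) (𝓝[>] 0)
        (𝓝 (ENNReal.ofReal (K * (b - a)))) := by
      have : Continuous fun ε : ℝ => ENNReal.ofReal (K * (b + ε - a)) :=
        ENNReal.continuous_ofReal.comp (by fun_prop)
      have h0 := this.tendsto 0
      rw [add_zero] at h0
      exact h0.mono_left nhdsWithin_le_nhds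
    refine ge_of_tendsto ht ?_
    filter_upwards [self_mem_nhdsWithin] with ε hε
    have hε' : 0 < ε := hε
    exact (measure_mono (Set.Ioc_subset_Ioo_right (by linarith))).trans (h a (b + ε) (by linarith))
  -- Lebesgue outer measure is the largest outer measure dominated by the Stieltjes length, which is
  -- computed from covering half-open intervals; hence the passage from `Ioo` to `Ioc`.
  have hle : ((ENNReal.ofReal K)⁻¹ • μ).toOuterMeasure ≤ StieltjesFunction.id.outer := by
    refine OuterMeasure.le_ofFunction.2 fun s => ?_
    rw [StieltjesFunction.length_eq]
    refine le_iInf fun a => le_iInf fun b => le_iInf fun hs => ?_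
    have hs' : s ⊆ Set.Ioc a b := by simpa [botSet, not_isBot] using hs
    change (ENNReal.ofReal K)⁻¹ * μ s ≤ _
    have hK0 : ENNReal.ofReal K ≠ 0 := by simpa using hK
    rw [mul_comm, ← div_eq_mul_inv, ENNReal.div_le_iff hK0 ENNReal.ofReal_ne_top, mul_comm,
      ← ENNReal.ofReal_mul hK.le]
    exact (measure_mono hs').trans (hIoc a b)
  intro s hs
  rw [Real.volume_eq_stieltjes_id, StieltjesFunction.measure] at hs
  have h2 : (ENNReal.ofReal K)⁻¹ * μ s ≤ 0 := (hle s).trans hs.le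
  simpa [ENNReal.inv_eq_zero] using h2

/-- Partial sums of a sequence of naturals that is infinitely often nonzero are unbounded. -/
theorem exists_le_sum_range_of_frequently_ne_zero {f : ℕ → ℕ} (hf : ∃ᶠ n in atTop, f n ≠ 0)
    (M : ℕ) : ∃ n, M ≤ ∑ i ∈ Finset.range n, f i := by
  induction M with
  | zero => exact ⟨0, Nat.zero_le _⟩
  | succ M ih =>
    obtain ⟨n, hn⟩ := ih
    obtain ⟨N, hN, hfN⟩ := Filter.frequently_atTop.1 hf n
    refine ⟨N + 1, ?_⟩
    rw [Finset.sum_range_succ]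
    have := Finset.sum_le_sum_of_subset (f := f) (Finset.range_mono hN)
    omega

/-- An open interval of length `L` contains at most `L + 1` integers. -/
theorem card_Ioo_floor_ceil_le {a b : ℝ} (hab : a ≤ b) :
    ((Finset.Ioo ⌊a⌋ ⌈b⌉).card : ℝ) ≤ b - a + 1 := by
  rw [Int.card_Ioo]
  have h1 := Int.lt_floor_add_one a
  have h2 := Int.ceil_lt_add_one b
  rcases le_total (⌈b⌉ - ⌊a⌋ - 1) 0 with h | h
  · rw [Int.toNat_of_nonpos h]
    simp
    linarith
  · have : (((⌈b⌉ - ⌊a⌋ - 1).toNat : ℤ) : ℝ) = ((⌈b⌉ - ⌊a⌋ - 1 : ℤ) : ℝ) := by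
      rw [Int.toNat_of_nonneg h]
    rw [Int.cast_natCast] at this
    rw [this]
    push_cast
    linarith

/-! ### Elementary properties and measurability of the urn counts -/

namespace UrnR

section Basic

variable {Ω : Type*} {W₀ B₀ c m : ℕ} {D : ℕ → Ω → ℕ}

theorem total_pos (hW₀ : 0 < W₀) (n : ℕ) : 0 < total W₀ B₀ c m n := by
  unfold total
  omega

theorem le_white (n : ℕ) (ω : Ω) : W₀ ≤ white W₀ c D n ω := Nat.le_add_right _ _

theorem le_black (n : ℕ) (ω : Ω) : B₀ ≤ black B₀ c m D n ω := Nat.le_add_right _ _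

theorem white_succ (n : ℕ) (ω : Ω) :
    white W₀ c D (n + 1) ω = white W₀ c D n ω + c * D n ω := by
  simp [white, Finset.sum_range_succ, add_assoc]

theorem white_mono (ω : Ω) : Monotone fun n => white W₀ c D n ω :=
  monotone_nat_of_le_succ fun n => by
    rw [white_succ]
    exact Nat.le_add_right _ _

theorem black_mono (ω : Ω) : Monotone fun n => black B₀ c m D n ω :=
  monotone_nat_of_le_succ fun n => by
    simp only [black, Finset.sum_range_succ]
    omega

theorem total_succ (n : ℕ) : total W₀ B₀ c m (n + 1) = total W₀ B₀ c m n + m * c := by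
  unfold total
  ring

theorem add_one_le_total (hW₀ : 0 < W₀) (hc : 0 < c) (hm : 0 < m) (n : ℕ) :
    n + 1 ≤ total W₀ B₀ c m n := by
  have h : n * 1 ≤ n * (m * c) := Nat.mul_le_mul_left n (Nat.mul_pos hm hc)
  rw [← mul_assoc] at h
  unfold total
  omega

theorem exists_le_white (hc : 0 < c) {ω : Ω} (h : ∃ᶠ n in atTop, D n ω ≠ 0) (M : ℕ) :
    ∃ n, M ≤ white W₀ c D n ω := by
  obtain ⟨n, hn⟩ := exists_le_sum_range_of_frequently_ne_zero h M
  refine ⟨n, ?_⟩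
  rw [white, ← Finset.mul_sum]
  exact hn.trans ((Nat.le_mul_of_pos_left _ hc).trans (Nat.le_add_left _ _))

theorem exists_le_black (hc : 0 < c) {ω : Ω} (h : ∃ᶠ n in atTop, m - D n ω ≠ 0) (M : ℕ) :
    ∃ n, M ≤ black B₀ c m D n ω := by
  obtain ⟨n, hn⟩ := exists_le_sum_range_of_frequently_ne_zero h M
  refine ⟨n, ?_⟩
  rw [black, ← Finset.mul_sum]
  exact hn.trans ((Nat.le_mul_of_pos_left _ hc).trans (Nat.le_add_left _ _))

/-- The conditional probability, given the past, that the sample drawn after `n` draws contains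
`k` white balls. -/
noncomputable def drawProb (W₀ B₀ c m : ℕ) (D : ℕ → Ω → ℕ) (n k : ℕ) (ω : Ω) : ℝ :=
  (m.choose k : ℝ) * (white W₀ c D n ω : ℝ) ^ k * (black B₀ c m D n ω : ℝ) ^ (m - k)
    / (total W₀ B₀ c m n : ℝ) ^ m

theorem proportion_pos (hW₀ : 0 < W₀) (n : ℕ) (ω : Ω) : 0 < proportion W₀ B₀ c m D n ω :=
  div_pos (Nat.cast_pos.2 (hW₀.trans_le (le_white n ω))) (Nat.cast_pos.2 (total_pos hW₀ n))

theorem measurable_draw [MeasurableSpace Ω] (hD : ∀ n, Measurable (D n)) {i n : ℕ} (hi : i < n) :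
    Measurable[drawFiltration D hD n] (D i) :=
  measurable_iff_comap_le.2 (le_iSup₂_of_le (f := fun i (_ : i ∈ Finset.range n) =>
    MeasurableSpace.comap (D i) inferInstance) i (Finset.mem_range.2 hi) le_rfl)

theorem measurable_white [MeasurableSpace Ω] (hD : ∀ n, Measurable (D n)) (n : ℕ) :
    Measurable[drawFiltration D hD n] (white W₀ c D n) :=
  Measurable.const_add (Finset.measurable_fun_sum _ fun _ hi =>
    (measurable_draw hD (Finset.mem_range.1 hi)).const_mul c) W₀

theorem measurable_black [MeasurableSpace Ω] (hD : ∀ n, Measurable (D n)) (n : ℕ) :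
    Measurable[drawFiltration D hD n] (black B₀ c m D n) :=
  Measurable.const_add (Finset.measurable_fun_sum _ fun _ hi =>
    ((measurable_from_top (f := fun j : ℕ => m - j)).comp
      (measurable_draw hD (Finset.mem_range.1 hi))).const_mul c) B₀

theorem measurable_proportion [MeasurableSpace Ω] (hD : ∀ n, Measurable (D n)) (n : ℕ) :
    Measurable[drawFiltration D hD n] (proportion W₀ B₀ c m D n) :=
  ((measurable_from_top (f := fun j : ℕ => (j : ℝ))).comp (measurable_white hD n)).div_const _

end Basic

/-! ### The martingale and its limit -/

section ModelR

variable {Ω : Type*} [MeasurableSpace Ω] {P : Measure Ω}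
  {W₀ B₀ c m : ℕ} {D : ℕ → Ω → ℕ}

theorem IsModelR.white_add_black_cast (hD : IsModelR P W₀ B₀ c m D) (n : ℕ) (ω : Ω) :
    (white W₀ c D n ω : ℝ) + black B₀ c m D n ω = total W₀ B₀ c m n := by
  exact_mod_cast white_add_black W₀ B₀ c m D hD.le n ω

theorem IsModelR.proportion_le_one (hD : IsModelR P W₀ B₀ c m D) (n : ℕ) (ω : Ω) :
    proportion W₀ B₀ c m D n ω ≤ 1 := by
  refine div_le_one_of_le₀ ?_ (Nat.cast_nonneg _)
  have h := hD.white_add_black_cast n ω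
  have h2 : (0 : ℝ) ≤ black B₀ c m D n ω := Nat.cast_nonneg _
  linarith

theorem IsModelR.measurableSet_draw_eq (hD : IsModelR P W₀ B₀ c m D) (n k : ℕ) :
    MeasurableSet {ω | D n ω = k} :=
  hD.measurable n (measurableSet_singleton k)

variable [IsProbabilityMeasure P]

theorem IsModelR.integrable_indicator (hD : IsModelR P W₀ B₀ c m D) (n k : ℕ) :
    Integrable (Set.indicator {ω | D n ω = k} fun _ => (1 : ℝ)) P :=
  (integrable_const 1).indicator (hD.measurableSet_draw_eq n k)

/-- Joint probability of an event of the past and of a sample composition. -/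
theorem IsModelR.measureReal_inter_draw (hD : IsModelR P W₀ B₀ c m D) {n k : ℕ} (hk : k ≤ m)
    {S : Set Ω} (hS : MeasurableSet[drawFiltration D hD.measurable n] S) :
    P.real (S ∩ {ω | D n ω = k}) = ∫ ω in S, drawProb W₀ B₀ c m D n k ω ∂P := by
  have hle := (drawFiltration D hD.measurable).le n
  have h1 := setIntegral_condExp hle (hD.integrable_indicator n k) hS
  rw [setIntegral_congr_ae (hle _ hS) ((hD.cond_prob n k hk).mono fun ω hω _ => hω)] at h1
  rw [setIntegral_indicator (hD.measurableSet_draw_eq n k)] at h1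
  simpa [drawProb] using h1.symm

/-- The mean of the binomial law, read off from the Bernstein polynomial identity `∑ k B_{m,k}(p) =
m p`. -/
theorem IsModelR.condExp_draw (hD : IsModelR P W₀ B₀ c m D) (hW₀ : 0 < W₀) (n : ℕ) :
    P[fun ω => (D n ω : ℝ) | drawFiltration D hD.measurable n]
      =ᵐ[P] fun ω => m * proportion W₀ B₀ c m D n ω := by
  have h1 : (fun ω => (D n ω : ℝ)) = ∑ k ∈ Finset.range (m + 1),
      (k : ℝ) • Set.indicator {ω | D n ω = k} (fun _ => (1 : ℝ)) := by
    funext ω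
    have := hD.le n ω
    simp only [Finset.sum_apply, Pi.smul_apply, Set.indicator_apply, Set.mem_ofPred_eq, smul_eq_mul,
      mul_ite, mul_one, mul_zero, Finset.sum_ite_eq, Finset.mem_range]
    rw [if_pos (by omega)]
  have h2 : ∀ᵐ ω ∂P, ∀ k ∈ Finset.range (m + 1),
      (P[(k : ℝ) • Set.indicator {ω | D n ω = k} (fun _ => (1 : ℝ)) |
        drawFiltration D hD.measurable n]) ω = k * drawProb W₀ B₀ c m D n k ω := by
    refine (Finset.eventually_all _).2 fun k hk => ?_
    filter_upwards [condExp_smul (μ := P) (k : ℝ)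
      (Set.indicator {ω | D n ω = k} (fun _ => (1 : ℝ))) (drawFiltration D hD.measurable n),
      hD.cond_prob n k (Nat.lt_succ_iff.1 (Finset.mem_range.1 hk))] with ω h3 h4
    rw [h3, Pi.smul_apply, h4, smul_eq_mul, drawProb]
  rw [h1]
  filter_upwards [condExp_finsetSum (μ := P) (s := Finset.range (m + 1))
    (f := fun k => (k : ℝ) • Set.indicator {ω | D n ω = k} (fun _ => (1 : ℝ)))
    (fun k _ => (hD.integrable_indicator n k).smul (k : ℝ))
    (drawFiltration D hD.measurable n), h2] with ω h3 h4
  rw [h3, Finset.sum_apply, Finset.sum_congr rfl h4]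
  have hT : (0 : ℝ) < total W₀ B₀ c m n := Nat.cast_pos.2 (total_pos hW₀ n)
  have h5 := congrArg (Polynomial.eval (proportion W₀ B₀ c m D n ω)) (bernsteinPolynomial.sum_smul ℝ m)
  simp only [bernsteinPolynomial, Polynomial.eval_finsetSum, nsmul_eq_mul,
    Polynomial.eval_mul, Polynomial.eval_natCast, Polynomial.eval_pow, Polynomial.eval_X,
    Polynomial.eval_sub, Polynomial.eval_one] at h5
  rw [← h5]
  refine Finset.sum_congr rfl fun k hk => ?_
  have hk' : k ≤ m := Nat.lt_succ_iff.1 (Finset.mem_range.1 hk)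
  have h6 : 1 - proportion W₀ B₀ c m D n ω
      = (black B₀ c m D n ω : ℝ) / total W₀ B₀ c m n := by
    rw [proportion, eq_div_iff hT.ne', sub_mul, div_mul_cancel₀ _ hT.ne',
      ← hD.white_add_black_cast n ω]
    ring
  have h7 : (total W₀ B₀ c m n : ℝ) ^ m
      = (total W₀ B₀ c m n : ℝ) ^ k * (total W₀ B₀ c m n : ℝ) ^ (m - k) := by
    rw [← pow_add, Nat.add_sub_cancel' hk']
  rw [h6, drawProb, proportion, div_pow, div_pow, h7]
  field_simp

theorem IsModelR.integrable_proportion (hD : IsModelR P W₀ B₀ c m D) (hW₀ : 0 < W₀) (n : ℕ) :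
    Integrable (proportion W₀ B₀ c m D n) P := by
  refine Integrable.of_bound (C := 1) (((measurable_proportion hD.measurable n).mono
    ((drawFiltration D hD.measurable).le n) le_rfl).aestronglyMeasurable)
    (ae_of_all _ fun ω => ?_)
  rw [Real.norm_of_nonneg (proportion_pos hW₀ n ω).le]
  exact hD.proportion_le_one n ω

theorem IsModelR.martingale_proportion (hD : IsModelR P W₀ B₀ c m D) (hW₀ : 0 < W₀) :
    Martingale (proportion W₀ B₀ c m D) (drawFiltration D hD.measurable) P := by
  refine martingale_nat (fun n => (measurable_proportion hD.measurable n).stronglyMeasurable)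
    (hD.integrable_proportion hW₀) fun n => ?_
  have hT : (0 : ℝ) < total W₀ B₀ c m n := Nat.cast_pos.2 (total_pos hW₀ n)
  have hT' : (0 : ℝ) < total W₀ B₀ c m (n + 1) := Nat.cast_pos.2 (total_pos hW₀ (n + 1))
  have hs : (total W₀ B₀ c m (n + 1) : ℝ) = total W₀ B₀ c m n + m * c := by
    exact_mod_cast total_succ n
  have h1 : proportion W₀ B₀ c m D (n + 1)
      = (total W₀ B₀ c m n / total W₀ B₀ c m (n + 1) : ℝ) • proportion W₀ B₀ c m D n
        + (c / total W₀ B₀ c m (n + 1) : ℝ) • fun ω => (D n ω : ℝ) := by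
    funext ω
    simp only [proportion, Pi.add_apply, Pi.smul_apply, smul_eq_mul, white_succ]
    push_cast
    field_simp
  have hDi : Integrable (fun ω => (D n ω : ℝ)) P := by
    refine Integrable.of_bound (C := m) ((measurable_from_top (f := fun j : ℕ => (j : ℝ))).comp
      (hD.measurable n)).aestronglyMeasurable (ae_of_all _ fun ω => ?_)
    rw [Real.norm_natCast]
    exact_mod_cast hD.le n ω
  have hp := hD.integrable_proportion hW₀ n
  rw [h1]
  filter_upwards [condExp_add (hp.smul (total W₀ B₀ c m n / total W₀ B₀ c m (n + 1) : ℝ))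
      (hDi.smul (c / total W₀ B₀ c m (n + 1) : ℝ)) (drawFiltration D hD.measurable n),
    condExp_smul (μ := P) (total W₀ B₀ c m n / total W₀ B₀ c m (n + 1) : ℝ)
      (proportion W₀ B₀ c m D n) (drawFiltration D hD.measurable n),
    condExp_smul (μ := P) (c / total W₀ B₀ c m (n + 1) : ℝ)
      (fun ω => (D n ω : ℝ)) (drawFiltration D hD.measurable n),
    hD.condExp_draw hW₀ n] with ω h2 h3 h4 h5
  rw [h2, Pi.add_apply, h3, h4, Pi.smul_apply, Pi.smul_apply, h5,
    condExp_of_stronglyMeasurable ((drawFiltration D hD.measurable).le n)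
      (measurable_proportion hD.measurable n).stronglyMeasurable hp, smul_eq_mul, smul_eq_mul]
  field_simp
  rw [hs]
  ring

theorem IsModelR.exists_measurable_tendsto (hD : IsModelR P W₀ B₀ c m D) (hW₀ : 0 < W₀) :
    ∃ X : Ω → ℝ, Measurable X ∧
      ∀ᵐ ω ∂P, Tendsto (fun n => proportion W₀ B₀ c m D n ω) atTop (𝓝 (X ω)) := by
  refine measurable_limit_of_tendsto_metrizable_ae (fun n => ((measurable_proportion
    hD.measurable n).mono ((drawFiltration D hD.measurable).le n) le_rfl).aemeasurable) ?_
  refine (hD.martingale_proportion hW₀).submartingale.exists_ae_tendsto_of_bdd (R := 1) fun n => ?_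
  refine (eLpNorm_le_of_ae_bound (C := 1) (ae_of_all _ fun ω => ?_)).trans ?_
  · rw [Real.norm_of_nonneg (proportion_pos hW₀ n ω).le]
    exact hD.proportion_le_one n ω
  · simp

/-! ### Both colours grow without bound -/

/-- A sample composition whose conditional probability stays away from `1` by the inverse of the
number of balls almost surely fails infinitely often. -/
theorem IsModelR.ae_frequently_draw_ne (hD : IsModelR P W₀ B₀ c m D) (hW₀ : 0 < W₀)
    {k : ℕ} (hk : k ≤ m)
    (h : ∀ n ω, drawProb W₀ B₀ c m D n k ω ≤ 1 - 1 / total W₀ B₀ c m n) :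
    ∀ᵐ ω ∂P, ∃ᶠ n in atTop, D n ω ≠ k := by
  -- The index is shifted because the conditional Borel–Cantelli lemma needs `s n` measurable at
  -- time `n`, whereas `D n` is known only at time `n + 1`; `s 0 = ∅` is a dummy.
  let s : ℕ → Set Ω := fun n => Nat.rec ∅ (fun i _ => {ω | D i ω = k}ᶜ) n
  have hs : ∀ n, MeasurableSet[drawFiltration D hD.measurable n] (s n) := by
    rintro (_ | n)
    · exact @MeasurableSet.empty _ (drawFiltration D hD.measurable 0)
    · exact (measurable_draw hD.measurable n.lt_succ_self (measurableSet_singleton k)).compl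
  have h1 : ∀ᵐ ω ∂P, ∀ n, 1 / (total W₀ B₀ c m n : ℝ) ≤
      (P[(s (n + 1)).indicator (1 : Ω → ℝ) | drawFiltration D hD.measurable n]) ω := by
    refine ae_all_iff.2 fun n => ?_
    have h2 : (s (n + 1)).indicator (1 : Ω → ℝ)
        = (fun _ => (1 : ℝ)) - Set.indicator {ω | D n ω = k} fun _ => (1 : ℝ) := by
      change {ω | D n ω = k}ᶜ.indicator (fun _ => (1 : ℝ)) = _
      rw [Set.indicator_compl]
    rw [h2]
    filter_upwards [condExp_sub (integrable_const (1 : ℝ)) (hD.integrable_indicator n k)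
      (drawFiltration D hD.measurable n), hD.cond_prob n k hk] with ω h3 h4
    rw [h3, Pi.sub_apply, h4, condExp_const ((drawFiltration D hD.measurable).le n)]
    have := h n ω
    rw [drawProb] at this
    linarith
  -- Comparison with the harmonic series: `T_n ≤ (W₀ + B₀ + m c)(n + 1)`.
  have hdiv : Tendsto (fun N => ∑ n ∈ Finset.range N, 1 / (total W₀ B₀ c m n : ℝ)) atTop atTop := by
    have hA : (0 : ℝ) < W₀ + B₀ + m * c := by
      have h5 : 0 < total W₀ B₀ c m 1 := total_pos hW₀ 1
      rw [total, one_mul] at h5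
      exact_mod_cast h5
    refine tendsto_atTop_mono (fun N => ?_)
      (Real.tendsto_sum_range_one_div_nat_succ_atTop.const_mul_atTop (inv_pos.2 hA))
    rw [Finset.mul_sum]
    refine Finset.sum_le_sum fun n _ => ?_
    rw [inv_mul_eq_div, div_div]
    refine one_div_le_one_div_of_le (Nat.cast_pos.2 (total_pos hW₀ n)) ?_
    have h6 : (0 : ℝ) ≤ (W₀ + B₀) * n + m * c := by positivity
    rw [total]
    push_cast
    linarith
  filter_upwards [ae_mem_limsup_atTop_iff P hs, h1] with ω h2 h3
  have h4 := h2.2 (tendsto_atTop_mono (fun N => Finset.sum_le_sum fun n _ => h3 n) hdiv)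
  rw [mem_limsup_iff_frequently_mem] at h4
  rw [← map_add_atTop_eq_nat 1, frequently_map] at h4
  exact h4

end ModelR

/-- Bounds the probability of a one-coloured sample, `y` being the count of that colour, when at
least one ball of the other colour is present. -/
theorem pow_div_pow_le_one_sub {x y T : ℝ} (hx : 1 ≤ x) (hy : 0 ≤ y) (h : x + y = T) {m : ℕ}
    (hm : 0 < m) : y ^ m / T ^ m ≤ 1 - 1 / T := by
  have hT : 0 < T := by linarith
  rw [← div_pow]
  calc (y / T) ^ m ≤ y / T :=
        pow_le_of_le_one (by positivity) (div_le_one_of_le₀ (by linarith) hT.le) hm.ne'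
    _ ≤ (T - 1) / T := by gcongr; linarith
    _ = 1 - 1 / T := by rw [sub_div, div_self hT.ne']

section ModelR

variable {Ω : Type*} [MeasurableSpace Ω] {P : Measure Ω} [IsProbabilityMeasure P]
  {W₀ B₀ c m : ℕ} {D : ℕ → Ω → ℕ}

theorem IsModelR.ae_exists_le_white (hD : IsModelR P W₀ B₀ c m D) (hW₀ : 0 < W₀) (hc : 0 < c)
    (hm : 0 < m) (M : ℕ) : ∀ᵐ ω ∂P, ∃ n, M ≤ white W₀ c D n ω := by
  filter_upwards [hD.ae_frequently_draw_ne hW₀ (Nat.zero_le m) fun n ω => by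
    have h1 : (1 : ℝ) ≤ white W₀ c D n ω := by exact_mod_cast hW₀.trans_le (le_white n ω)
    simpa [drawProb] using
      pow_div_pow_le_one_sub h1 (Nat.cast_nonneg _) (hD.white_add_black_cast n ω) hm] with ω h
  exact exists_le_white hc h M

theorem IsModelR.ae_exists_le_black (hD : IsModelR P W₀ B₀ c m D) (hW₀ : 0 < W₀) (hB₀ : 0 < B₀)
    (hc : 0 < c) (hm : 0 < m) (M : ℕ) : ∀ᵐ ω ∂P, ∃ n, M ≤ black B₀ c m D n ω := by
  filter_upwards [hD.ae_frequently_draw_ne hW₀ le_rfl fun n ω => by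
    have h1 : (1 : ℝ) ≤ black B₀ c m D n ω := by exact_mod_cast hB₀.trans_le (le_black n ω)
    simpa [drawProb] using pow_div_pow_le_one_sub h1 (Nat.cast_nonneg _)
      ((add_comm _ _).trans (hD.white_add_black_cast n ω)) hm] with ω h
  refine exists_le_black hc (h.mono fun n hn => ?_) M
  have := hD.le n ω
  omega

/-! ### Bounds on point probabilities -/

/-- One step estimate for the point probabilities of the number of white balls on an event on
which both colours are sufficiently represented. -/
theorem IsModelR.measureReal_white_succ_le (hD : IsModelR P W₀ B₀ c m D) (hW₀ : 0 < W₀)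
    {C : ℝ} (hC0 : 0 ≤ C) (hC : ∀ T : ℝ, 1 ≤ T → (T + m * c) * (∑ i ∈ Finset.range (m + 1),
      (m.choose i : ℝ) * i.factorial * (-c : ℝ) ^ i * T ^ (m - i)) ≤ T ^ m * (T + C / T))
    {n : ℕ} {E : Set Ω} (hE : MeasurableSet[drawFiltration D hD.measurable n] E)
    (hEc : ∀ ω ∈ E, c * m ≤ white W₀ c D n ω ∧ c * m ≤ black B₀ c m D n ω) {a : ℝ} (ha : 0 ≤ a)
    (hp : ∀ v : ℤ, P.real (E ∩ {ω | (white W₀ c D n ω : ℤ) = v}) * total W₀ B₀ c m n ≤ a)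
    (v : ℤ) :
    P.real (E ∩ {ω | (white W₀ c D (n + 1) ω : ℤ) = v}) * total W₀ B₀ c m (n + 1)
      ≤ a * (1 + C / (total W₀ B₀ c m n : ℝ) ^ 2) := by
  have hs : (total W₀ B₀ c m (n + 1) : ℝ) = total W₀ B₀ c m n + m * c := by
    exact_mod_cast total_succ n
  set T : ℝ := (total W₀ B₀ c m n : ℝ) with hTdef
  have hT1 : 1 ≤ T := Nat.one_le_cast.2 (total_pos hW₀ n)
  have hT : 0 < T := by linarith
  -- A point `ω₀` of the event forces `c m ≤ v` and `c m ≤ T_{n+1} - v`. Hence `v - c k` and `T - (v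
  -- - c k)` are nonnegative for every `k ≤ m`, even where the event with `W_n = v - c k` is empty,
  -- so `a / T` can be inserted in all terms and the full Jensen sum appears.
  rcases (E ∩ {ω | (white W₀ c D (n + 1) ω : ℤ) = v}).eq_empty_or_nonempty with h0 | ⟨ω₀, h1, h2⟩
  · rw [h0, measureReal_empty, zero_mul]
    positivity
  have h2' : (white W₀ c D (n + 1) ω₀ : ℤ) = v := h2
  have hv1 : (c * m : ℝ) ≤ v := by
    rw [← h2']
    exact_mod_cast (hEc ω₀ h1).1.trans (white_mono ω₀ n.le_succ)
  have hv2 : (c * m : ℝ) ≤ T + m * c - v := by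
    rw [← h2', ← hs, ← hD.white_add_black_cast (n + 1) ω₀, Int.cast_natCast, add_sub_cancel_left]
    exact_mod_cast (hEc ω₀ h1).2.trans (black_mono ω₀ n.le_succ)
  have hsub : E ∩ {ω | (white W₀ c D (n + 1) ω : ℤ) = v} ⊆ ⋃ k ∈ Finset.range (m + 1),
      (E ∩ {ω | (white W₀ c D n ω : ℤ) = v - c * k}) ∩ {ω | D n ω = k} := by
    rintro ω ⟨hω, hω'⟩
    have hω'' : (white W₀ c D (n + 1) ω : ℤ) = v := hω'
    have := hD.le n ω
    refine Set.mem_biUnion (x := D n ω) (Finset.mem_coe.2 (Finset.mem_range.2 (by omega)))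
      ⟨⟨hω, ?_⟩, rfl⟩
    change (white W₀ c D n ω : ℤ) = v - c * D n ω
    rw [white_succ] at hω''
    push_cast at hω''
    linarith
  have hterm : ∀ k ∈ Finset.range (m + 1),
      P.real ((E ∩ {ω | (white W₀ c D n ω : ℤ) = v - c * k}) ∩ {ω | D n ω = k}) ≤
        a / T / T ^ m * ((m.choose k : ℝ) * ((v : ℝ) + k * (-c : ℝ)) ^ k *
          (T - ((v : ℝ) + k * (-c : ℝ))) ^ (m - k)) := by
    intro k hk
    have hk' : k ≤ m := Nat.lt_succ_iff.1 (Finset.mem_range.1 hk)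
    have hkm : (c : ℝ) * k ≤ c * m := by gcongr
    have hS : MeasurableSet[drawFiltration D hD.measurable n]
        (E ∩ {ω | (white W₀ c D n ω : ℤ) = v - c * k}) :=
      hE.inter (((measurable_from_top (f := fun j : ℕ => (j : ℤ))).comp
        (measurable_white hD.measurable n)) (measurableSet_singleton (v - c * k : ℤ)))
    have hint : ∀ ω ∈ E ∩ {ω | (white W₀ c D n ω : ℤ) = v - c * k},
        drawProb W₀ B₀ c m D n k ω = (m.choose k : ℝ) * ((v : ℝ) + k * (-c : ℝ)) ^ k *
          (T - ((v : ℝ) + k * (-c : ℝ))) ^ (m - k) / T ^ m := by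
      rintro ω ⟨-, hω⟩
      have hω' : (white W₀ c D n ω : ℤ) = v - c * k := hω
      have hw : (white W₀ c D n ω : ℝ) = (v : ℝ) + k * (-c : ℝ) := by
        have : ((white W₀ c D n ω : ℤ) : ℝ) = ((v - c * k : ℤ) : ℝ) := by rw [hω']
        push_cast at this
        linarith
      have hb : (black B₀ c m D n ω : ℝ) = T - ((v : ℝ) + k * (-c : ℝ)) := by
        rw [← hw, hTdef, ← hD.white_add_black_cast n ω, add_sub_cancel_left]
      rw [drawProb, hw, hb]
    rw [hD.measureReal_inter_draw hk' hS,
      setIntegral_congr_fun ((drawFiltration D hD.measurable).le n _ hS) hint,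
      setIntegral_const, smul_eq_mul]
    have hq : P.real (E ∩ {ω | (white W₀ c D n ω : ℤ) = v - c * k}) ≤ a / T :=
      (le_div_iff₀ hT).2 (hp _)
    have hx : 0 ≤ (v : ℝ) + k * (-c : ℝ) := by linarith
    have hy : 0 ≤ T - ((v : ℝ) + k * (-c : ℝ)) := by
      have : 0 ≤ (c : ℝ) * k := by positivity
      linarith
    calc _ ≤ a / T * ((m.choose k : ℝ) * ((v : ℝ) + k * (-c : ℝ)) ^ k *
          (T - ((v : ℝ) + k * (-c : ℝ))) ^ (m - k) / T ^ m) := by gcongr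
      _ = _ := by ring
  have hsum : P.real (E ∩ {ω | (white W₀ c D (n + 1) ω : ℤ) = v}) ≤
      a / T / T ^ m * ∑ i ∈ Finset.range (m + 1),
        (m.choose i : ℝ) * i.factorial * (-c : ℝ) ^ i * T ^ (m - i) := by
    rw [← sum_choose_mul_add_pow_mul_sub_pow m v T (-c : ℝ), Finset.mul_sum]
    exact (measureReal_mono hsub (measure_ne_top _ _)).trans
      ((measureReal_biUnion_finset_le _ _).trans (Finset.sum_le_sum hterm))
  rw [hs]
  calc _ ≤ (a / T / T ^ m * ∑ i ∈ Finset.range (m + 1),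
        (m.choose i : ℝ) * i.factorial * (-c : ℝ) ^ i * T ^ (m - i)) * (T + m * c) := by gcongr
    _ = a / T / T ^ m * ((T + m * c) * ∑ i ∈ Finset.range (m + 1),
        (m.choose i : ℝ) * i.factorial * (-c : ℝ) ^ i * T ^ (m - i)) := by ring
    _ ≤ a / T / T ^ m * (T ^ m * (T + C / T)) := by
        exact mul_le_mul_of_nonneg_left (hC T hT1) (by positivity)
    _ = _ := by field_simp

/-- On an event on which both colours are sufficiently represented, the point probabilities of the
number of white balls are of the order of the inverse of the number of balls. -/
theorem IsModelR.exists_measureReal_white_le (hD : IsModelR P W₀ B₀ c m D) (hW₀ : 0 < W₀)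
    (hc : 0 < c) (hm : 0 < m) {l : ℕ} {E : Set Ω}
    (hE : MeasurableSet[drawFiltration D hD.measurable l] E)
    (hEc : ∀ ω ∈ E, c * m ≤ white W₀ c D l ω ∧ c * m ≤ black B₀ c m D l ω) :
    ∃ K : ℝ, 0 < K ∧ ∀ n, l ≤ n → ∀ v : ℤ,
      P.real (E ∩ {ω | (white W₀ c D n ω : ℤ) = v}) * total W₀ B₀ c m n ≤ K := by
  obtain ⟨C, hC0, hC⟩ := exists_jensen_sum_le c m
  have hTl : (0 : ℝ) < total W₀ B₀ c m l := Nat.cast_pos.2 (total_pos hW₀ l)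
  have hsumm : Summable fun i : ℕ => C / ((i : ℝ) + 1) ^ 2 := by
    have h := (summable_nat_add_iff 1).2 (Real.summable_one_div_nat_pow.2 (one_lt_two))
    simpa [div_eq_mul_inv] using h.mul_left C
  -- The factors `1 + C / T_n^2` are at most `exp (C / (n + 1)^2)` as `T_n ≥ n + 1`. The exponents
  -- with `i < l` are superfluous but nonnegative.
  have key : ∀ n, l ≤ n → ∀ v : ℤ,
      P.real (E ∩ {ω | (white W₀ c D n ω : ℤ) = v}) * total W₀ B₀ c m n ≤
        total W₀ B₀ c m l * Real.exp (∑ i ∈ Finset.range n, C / ((i : ℝ) + 1) ^ 2) := by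
    intro n hn
    induction n, hn using Nat.le_induction with
    | base =>
      intro v
      rw [mul_comm]
      gcongr
      exact measureReal_le_one.trans
        (Real.one_le_exp (Finset.sum_nonneg fun i _ => by positivity))
    | succ n hn ih =>
      intro v
      refine (hD.measureReal_white_succ_le hW₀ hC0 hC ((drawFiltration D hD.measurable).mono hn _ hE)
        (fun ω hω => ⟨(hEc ω hω).1.trans (white_mono ω hn), (hEc ω hω).2.trans (black_mono ω hn)⟩)
        (by positivity) ih v).trans ?_
      rw [Finset.sum_range_succ, Real.exp_add, ← mul_assoc]
      gcongr
      have h1 : ((n : ℝ) + 1) ≤ total W₀ B₀ c m n := by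
        exact_mod_cast add_one_le_total hW₀ hc hm n
      calc 1 + C / (total W₀ B₀ c m n : ℝ) ^ 2 ≤ 1 + C / ((n : ℝ) + 1) ^ 2 := by gcongr
        _ ≤ _ := by
          rw [add_comm]
          exact Real.add_one_le_exp _
  refine ⟨total W₀ B₀ c m l * Real.exp (∑' i : ℕ, C / ((i : ℝ) + 1) ^ 2), by positivity,
    fun n hn v => (key n hn v).trans ?_⟩
  gcongr
  exact hsumm.sum_le_tsum _ fun i _ => by positivity

/-! ### Absolute continuity of the limit law -/

/-- The white count lies strictly between `aT` and `bT`, which allows at most `(b - a)T + 1`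
integers, each of probability at most `K / T`. -/
theorem measureReal_proportion_mem_Ioo_le (hW₀ : 0 < W₀) {n : ℕ} {E : Set Ω} {K : ℝ}
    (hK : ∀ v : ℤ, P.real (E ∩ {ω | (white W₀ c D n ω : ℤ) = v}) * total W₀ B₀ c m n ≤ K)
    {a b : ℝ} (hab : a < b) :
    P.real (E ∩ {ω | proportion W₀ B₀ c m D n ω ∈ Set.Ioo a b}) ≤
      K * (b - a) + K / total W₀ B₀ c m n := by
  set T : ℝ := (total W₀ B₀ c m n : ℝ) with hTdef
  have hT : 0 < T := Nat.cast_pos.2 (total_pos hW₀ n)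
  have hsub : E ∩ {ω | proportion W₀ B₀ c m D n ω ∈ Set.Ioo a b} ⊆
      ⋃ v ∈ Finset.Ioo ⌊a * T⌋ ⌈b * T⌉, E ∩ {ω | (white W₀ c D n ω : ℤ) = v} := by
    rintro ω ⟨hω, h1, h2⟩
    rw [proportion, lt_div_iff₀ hT] at h1
    rw [proportion, div_lt_iff₀ hT] at h2
    refine Set.mem_biUnion (x := (white W₀ c D n ω : ℤ)) (Finset.mem_coe.2 (Finset.mem_Ioo.2
      ⟨Int.floor_lt.2 ?_, Int.lt_ceil.2 ?_⟩)) ⟨hω, rfl⟩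
    · exact_mod_cast h1
    · exact_mod_cast h2
  have hK0 : 0 ≤ K := (by positivity : (0 : ℝ) ≤ _).trans (hK 0)
  calc _ ≤ ∑ v ∈ Finset.Ioo ⌊a * T⌋ ⌈b * T⌉, P.real (E ∩ {ω | (white W₀ c D n ω : ℤ) = v}) :=
        (measureReal_mono hsub (measure_ne_top _ _)).trans (measureReal_biUnion_finset_le _ _)
    _ ≤ ∑ _v ∈ Finset.Ioo ⌊a * T⌋ ⌈b * T⌉, K / T :=
        Finset.sum_le_sum fun v _ => (le_div_iff₀ hT).2 (hK v)
    _ = (Finset.Ioo ⌊a * T⌋ ⌈b * T⌉).card * (K / T) := by rw [Finset.sum_const, nsmul_eq_mul]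
    _ ≤ (b * T - a * T + 1) * (K / T) := by
        gcongr
        exact card_Ioo_floor_ceil_le (by gcongr)
    _ = _ := by
        field_simp

/-- The limit of the proportions has a bounded density on an event on which both colours are
sufficiently represented. -/
theorem IsModelR.map_restrict_absolutelyContinuous (hD : IsModelR P W₀ B₀ c m D) (hW₀ : 0 < W₀)
    (hc : 0 < c) (hm : 0 < m) {X : Ω → ℝ} (hX : Measurable X)
    (hlim : ∀ᵐ ω ∂P, Tendsto (fun n => proportion W₀ B₀ c m D n ω) atTop (𝓝 (X ω)))
    {l : ℕ} {E : Set Ω} (hE : MeasurableSet[drawFiltration D hD.measurable l] E)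
    (hEc : ∀ ω ∈ E, c * m ≤ white W₀ c D l ω ∧ c * m ≤ black B₀ c m D l ω) :
    (P.restrict E).map X ≪ volume := by
  obtain ⟨K, hK0, hK⟩ := hD.exists_measureReal_white_le hW₀ hc hm hE hEc
  refine absolutelyContinuous_of_measure_Ioo_le hK0 fun a b hab => ?_
  rw [Measure.map_apply hX measurableSet_Ioo, Measure.restrict_apply (hX measurableSet_Ioo)]
  -- As `(a, b)` is open, a limit inside it keeps the proportions inside it from some `N` on. Each
  -- `G N` is bounded at every late time `n`, and the error `K / T_n` vanishes as `n → ∞`.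
  let G : ℕ → Set Ω := fun N => {ω ∈ E | ∀ n, N ≤ n → proportion W₀ B₀ c m D n ω ∈ Set.Ioo a b}
  have hG : Monotone G := fun N M hNM ω hω => ⟨hω.1, fun n hn => hω.2 n (hNM.trans hn)⟩
  have h1 : P (X ⁻¹' Set.Ioo a b ∩ E) ≤ P (⋃ N, G N) := by
    refine measure_mono_ae ?_
    filter_upwards [hlim] with ω hω hmem
    obtain ⟨N, hN⟩ := eventually_atTop.1 (hω.eventually_mem (isOpen_Ioo.mem_nhds hmem.1))
    exact Set.mem_iUnion.2 ⟨N, hmem.2, hN⟩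
  refine h1.trans ?_
  rw [hG.measure_iUnion]
  refine iSup_le fun N => ?_
  rw [← ofReal_measureReal]
  refine ENNReal.ofReal_le_ofReal ?_
  have hT : Tendsto (fun n => (total W₀ B₀ c m n : ℝ)) atTop atTop :=
    tendsto_natCast_atTop_atTop.comp (tendsto_atTop_mono
      (fun n => n.le_succ.trans (add_one_le_total hW₀ hc hm n)) tendsto_id)
  have hlimK : Tendsto (fun n => K * (b - a) + K / (total W₀ B₀ c m n : ℝ)) atTop
      (𝓝 (K * (b - a))) := by
    simpa using (hT.const_div_atTop K).const_add (K * (b - a))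
  refine ge_of_tendsto hlimK ?_
  filter_upwards [eventually_ge_atTop l, eventually_ge_atTop N] with n hn hN
  have hsub : G N ⊆ E ∩ {ω | proportion W₀ B₀ c m D n ω ∈ Set.Ioo a b} :=
    fun ω hω => ⟨hω.1, hω.2 n hN⟩
  exact (measureReal_mono hsub).trans
    (measureReal_proportion_mem_Ioo_le hW₀ (hK n hn) hab)

/-- The density bound `K` depends on `l` and may blow up with it, but null sets survive the
countable union of the events `E l`, which has full probability. -/
theorem IsModelR.map_absolutelyContinuous (hD : IsModelR P W₀ B₀ c m D) (hW₀ : 0 < W₀)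
    (hB₀ : 0 < B₀) (hc : 0 < c) (hm : 0 < m) {X : Ω → ℝ} (hX : Measurable X)
    (hlim : ∀ᵐ ω ∂P, Tendsto (fun n => proportion W₀ B₀ c m D n ω) atTop (𝓝 (X ω))) :
    P.map X ≪ volume := by
  let E : ℕ → Set Ω := fun l => {ω | c * m ≤ white W₀ c D l ω ∧ c * m ≤ black B₀ c m D l ω}
  have hE : ∀ l, MeasurableSet[drawFiltration D hD.measurable l] (E l) := fun l =>
    (measurable_white hD.measurable l measurableSet_Ici).inter
      (measurable_black hD.measurable l measurableSet_Ici)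
  refine Measure.AbsolutelyContinuous.mk fun A hA hA0 => ?_
  have h1 : ∀ l, P (X ⁻¹' A ∩ E l) = 0 := by
    intro l
    have h := hD.map_restrict_absolutelyContinuous hW₀ hc hm hX hlim (hE l) (fun ω hω => hω) hA0
    rwa [Measure.map_apply hX hA, Measure.restrict_apply (hX hA)] at h
  rw [Measure.map_apply hX hA]
  have h2 : P (X ⁻¹' A) ≤ P (⋃ l, X ⁻¹' A ∩ E l) := by
    refine measure_mono_ae ?_
    filter_upwards [hD.ae_exists_le_white hW₀ hc hm (c * m),
      hD.ae_exists_le_black hW₀ hB₀ hc hm (c * m)] with ω hw hb hmem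
    obtain ⟨n₁, hn₁⟩ := hw
    obtain ⟨n₂, hn₂⟩ := hb
    exact Set.mem_iUnion.2 ⟨max n₁ n₂, hmem, hn₁.trans (white_mono ω (le_max_left _ _)),
      hn₂.trans (black_mono ω (le_max_right _ _))⟩
  exact le_antisymm (h2.trans (measure_iUnion_null h1).le) zero_le

end ModelR

end UrnR

theorem mainTheorem4 {Ω : Type*} [MeasurableSpace Ω] (P : Measure Ω) [IsProbabilityMeasure P]
    (W₀ B₀ c m : ℕ) (hW₀ : 0 < W₀) (hB₀ : 0 < B₀) (hc : 0 < c) (hm : 0 < m)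
    (D : ℕ → Ω → ℕ) (hD : UrnR.IsModelR P W₀ B₀ c m D) :
    (∀ n ω, 0 < UrnR.proportion W₀ B₀ c m D n ω) ∧
    Martingale (UrnR.proportion W₀ B₀ c m D) (UrnR.drawFiltration D hD.measurable) P ∧
    ∃ Winf : Ω → ℝ, Measurable Winf ∧
      (∀ᵐ ω ∂P, Tendsto (fun n => UrnR.proportion W₀ B₀ c m D n ω) atTop (𝓝 (Winf ω))) ∧
      P.map Winf ≪ (volume : Measure ℝ) := by
  obtain ⟨X, hX, hlim⟩ := hD.exists_measurable_tendsto hW₀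
  exact ⟨UrnR.proportion_pos hW₀, hD.martingale_proportion hW₀, X, hX, hlim,
    hD.map_absolutelyContinuous hW₀ hB₀ hc hm hX hlim⟩
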